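/- **Theorem 3.9.** Let $G_0$ and $G_1$ be arbitrary finite matroids (loops and parallel elements are allowed), let $R$ be a commutative ring, and let $p$ and $q$ be points of the ground sets of $G_0$ and $G_1$, respectively. Let $P(G_0,G_1)$ be a parallel connection of $G_0$ and $G_1$ at $p$ and $q$, i.e. a matroid with a base point $b$ that is a union of pointed submatroids isomorphic to $(G_0,p)$ and $(G_1,q)$ whose ground sets meet only in the base point $b$, and that has the largest rank among all such unions (for $p,q$ not loops it exists and is unique up to isomorphism). Let $\{0\}$ denote the matroid of rank one with a single point, an isthmus. Then the matroids $$G=G_0\oplus G_1\qquad\text{and}\qquad G'=\{0\}\oplus P(G_0,G_1)$$ have isomorphic Orlik–Solomon algebras: there is an isomorphism of graded $R$-algebras $\mathcal A(G)\cong\mathcal A(G')$. Here, for a matroid $M$ with finite ground set $E$, $\mathcal A(M)=\mathcal E/\mathcal I$, where $\mathcal E=\Lambda_R(e_i : i\in E)$ is the exterior algebra over $R$ with its standard grading and $\mathcal I$ is the two-sided ideal generated by all $$\partial(e_{i_1}\wedge\cdots\wedge e_{i_n})=\sum_{k=1}^n(-1)^{k-1}e_{i_1}\wedge\cdots\wedge\widehat{e}_{i_k}\wedge\cdots\wedge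 e_{i_n}$$ with $\{i_1,\dots,i_n\}$ dependent in $M$. -/

import Mathlib

noncomputable section

namespace OrlikSolomon

open scoped Matroid

/-- The generator `e_i` of the exterior algebra `Λ(e_i : i ∈ X)` on the free module with basis
`X`. -/
def gen (R : Type*) [CommRing R] {X : Type*} (i : X) : ExteriorAlgebra R (X →₀ R) :=
  ExteriorAlgebra.ι R (Finsupp.single i 1)

/-- The monomial `e_S = e_{i_1} ∧ ⋯ ∧ e_{i_n}` of an ordered tuple `S = (i_1, …, i_n)`. -/
def monomial (R : Type*) [CommRing R] {X : Type*} {n : ℕ} (S : Fin n → X) :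
    ExteriorAlgebra R (X →₀ R) :=
  (List.ofFn fun k => gen R (S k)).prod

/-- The boundary map `∂` of the exterior algebra: the left contraction with the linear form
that takes the value `1` on each basis vector. Its values on monomials are the usual alternating
sums, see `boundary_monomial`. -/
def boundary (R : Type*) [CommRing R] (X : Type*) :
    ExteriorAlgebra R (X →₀ R) →ₗ[R] ExteriorAlgebra R (X →₀ R) :=
  CliffordAlgebra.contractLeft (Q := (0 : QuadraticForm R (X →₀ R)))
    (Finsupp.linearCombination R fun _ : X => (1 : R))

/-- `∂(e_{i_0} ∧ ⋯ ∧ e_{i_n}) = ∑_k (-1)^k e_{i_0} ∧ ⋯ ∧ ê_{i_k} ∧ ⋯ ∧ e_{i_n}` (with indices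
counted from `0`). -/
theorem boundary_monomial (R : Type*) [CommRing R] {X : Type*} {n : ℕ} (S : Fin (n + 1) → X) :
    boundary R X (monomial R S) =
      ∑ k : Fin (n + 1), (-1 : R) ^ (k : ℕ) • monomial R (fun j => S (k.succAbove j)) := by
  have key : ∀ {m : ℕ} (T : Fin (m + 1) → X), boundary R X (monomial R T) =
      monomial R (fun j => T j.succ) -
        gen R (T 0) * boundary R X (monomial R (fun j => T j.succ)) := by
    intro m T
    have h := CliffordAlgebra.contractLeft_ι_mul (Q := (0 : QuadraticForm R (X →₀ R)))
      (Finsupp.linearCombination R fun _ : X => (1 : R)) (Finsupp.single (T 0) 1)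
      (monomial R (fun j => T j.succ))
    simp only [Finsupp.linearCombination_single, smul_eq_mul, mul_one, one_smul] at h
    simpa [boundary, monomial, gen, List.ofFn_succ, ExteriorAlgebra.ι] using h
  induction n with
  | zero =>
    rw [key]
    have h1 : boundary R X (monomial R (fun j : Fin 0 => S j.succ)) = 0 := by
      simp [boundary, monomial]
    rw [h1]
    simp [monomial]
  | succ n ih =>
    rw [key, ih, Fin.sum_univ_succ (n := n + 1), sub_eq_add_neg, Finset.mul_sum,
      ← Finset.sum_neg_distrib]
    congr 1
    · simp
    · refine Finset.sum_congr rfl fun k _ => ?_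
      simp [monomial, List.ofFn_succ, pow_succ]

/-- The Orlik–Solomon ideal of `M`: the two-sided ideal of `Λ(e_i : i ∈ M.E)` generated by all
`∂ e_S` with `S` dependent. -/
def osIdeal (R : Type*) [CommRing R] {α : Type*} (M : Matroid α) :
    Ideal (ExteriorAlgebra R (M.E →₀ R)) :=
  (TwoSidedIdeal.span {x | ∃ (n : ℕ) (S : Fin n → M.E),
    M.Dep (Set.range fun k => (S k : α)) ∧ x = boundary R M.E (monomial R S)}).asIdeal

instance (R : Type*) [CommRing R] {α : Type*} (M : Matroid α) : (osIdeal R M).IsTwoSided :=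
  inferInstanceAs (TwoSidedIdeal.asIdeal _).IsTwoSided

/-- The Orlik–Solomon algebra of the matroid `M` with coefficients in `R`. -/
abbrev OSAlgebra (R : Type*) [CommRing R] {α : Type*} (M : Matroid α) : Type _ :=
  ExteriorAlgebra R (M.E →₀ R) ⧸ osIdeal R M

/-- The homogeneous part of degree `n` of the Orlik–Solomon algebra: the image of `Λⁿ`. -/
def osDegree (R : Type*) [CommRing R] {α : Type*} (M : Matroid α) (n : ℕ) :
    Submodule R (OSAlgebra R M) :=
  (⋀[R]^n (M.E →₀ R)).map (Ideal.Quotient.mkₐ R (osIdeal R M)).toLinearMap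

/-- `M` and `N` have isomorphic Orlik–Solomon algebras, as graded `R`-algebras. -/
def HasIsomorphicOSAlgebras (R : Type*) [CommRing R] {α β : Type*} (M : Matroid α)
    (N : Matroid β) : Prop :=
  ∃ φ : OSAlgebra R M ≃ₐ[R] OSAlgebra R N,
    ∀ n : ℕ, (osDegree R M n).map φ.toLinearMap = osDegree R N n

/-- `f` identifies `M` with the submatroid of `P` on the set `f '' M.E`. -/
structure IsSubmatroidEmbedding {α γ : Type*} (M : Matroid α) (P : Matroid γ) (f : α → γ) :
    Prop where
  injOn : Set.InjOn f M.E
  image_subset : f '' M.E ⊆ P.E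
  restrict_eq : P ↾ (f '' M.E) = M.map f injOn

/-- The matroid `P` with base point `b` is the union of two pointed submatroids, isomorphic to
`G₀` with base point `p` and to `G₁` with base point `q`, whose ground sets meet only in `b`. -/
def IsPointedUnion {α β γ : Type*} (G₀ : Matroid α) (p : α) (G₁ : Matroid β) (q : β)
    (P : Matroid γ) (b : γ) : Prop :=
  p ∈ G₀.E ∧ q ∈ G₁.E ∧ ∃ (f₀ : α → γ) (f₁ : β → γ),
    IsSubmatroidEmbedding G₀ P f₀ ∧ IsSubmatroidEmbedding G₁ P f₁ ∧
    f₀ p = b ∧ f₁ q = b ∧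
    P.E = (f₀ '' G₀.E) ∪ (f₁ '' G₁.E) ∧
    (f₀ '' G₀.E) ∩ (f₁ '' G₁.E) = {b}

/-- `(P, b)` is a parallel connection of the pointed matroids `(G₀, p)` and `(G₁, q)`: a pointed
union of copies of them of the largest possible rank. All pointed unions of (finite) `G₀` and `G₁`
have equally large ground sets, so up to isomorphism it is enough to compare with those that live
in the same type. -/
structure IsParallelConnection {α β γ : Type*} (G₀ : Matroid α) (p : α) (G₁ : Matroid β) (q : β)
    (P : Matroid γ) (b : γ) : Prop where
  isPointedUnion : IsPointedUnion G₀ p G₁ q P b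
  eRank_le : ∀ (P' : Matroid γ) (b' : γ), IsPointedUnion G₀ p G₁ q P' b' → P'.eRank ≤ P.eRank

/-- The matroid `{0}` of rank one with a single point, an isthmus. -/
def isthmus : Matroid Unit := Matroid.freeOn Set.univ

end OrlikSolomon

end

/-! The isomorphism comes from a linear change of generators. Write `b` for the base point and `z`
for the isthmus. Generators of `G₀` go to their copies in `P`; a generator of `G₁` goes to its copy
plus `e_z - e_b`, so that `e_q` goes to `e_z`. This is invertible and preserves the sum of
coordinates, hence commutes with `∂`. Translating all generators by a vector `v` acts on the
exterior algebra as `x ↦ x + v ∧ ∂x`, which fixes every `∂x` because `∂² = 0`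
(`map_translation_boundary`). So the boundary of a monomial from either piece goes to the boundary
of its copy.

It remains to see that both Orlik–Solomon ideals are generated by the boundaries coming from
dependent sets of the two pieces. For the direct sum this holds because a dependent set has a
dependent trace on a summand. In `P` there may also be a dependent `S` avoiding `b` with both traces
dependent only after `b` is added; `listMonomial_mul_mem` places its monomial in the ideal.

That nothing else is dependent in `P` (`dep_inter_or_of_dep`) is where maximal rank enters. If `b`
is not a loop, an explicit union with enough rank is built from its independent sets. Comparison
with it gives `r(E₀) + r(E₁) ≤ r(P) + 1`, which forces independence of the remaining sets by
counting bases. If `b` is a loop, no rank bound is needed. -/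

noncomputable section

namespace OrlikSolomon

open scoped Matroid
open ExteriorAlgebra

/-! ### Boundary, translations and monomials in the exterior algebra. -/

section Algebra

variable {R : Type*} [CommRing R] {X Y A : Type*}

variable (R X) in
/-- The linear form that takes the value `1` on each basis vector. -/
def coordSum : (X →₀ R) →ₗ[R] R := Finsupp.linearCombination R fun _ : X => (1 : R)

@[simp]
theorem coordSum_single (a : X) (r : R) : coordSum R X (Finsupp.single a r) = r := by
  simp [coordSum]

theorem boundary_ι_mul (v : X →₀ R) (x : ExteriorAlgebra R (X →₀ R)) :
    boundary R X (ι R v * x) = coordSum R X v • x - ι R v * boundary R X x :=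
  CliffordAlgebra.contractLeft_ι_mul (Q := (0 : QuadraticForm R (X →₀ R))) _ _ _

theorem boundary_gen_mul (a : X) (x : ExteriorAlgebra R (X →₀ R)) :
    boundary R X (gen R a * x) = x - gen R a * boundary R X x := by
  simp [gen, boundary_ι_mul]

theorem boundary_algebraMap (r : R) : boundary R X (algebraMap R _ r) = 0 :=
  CliffordAlgebra.contractLeft_algebraMap (Q := (0 : QuadraticForm R (X →₀ R))) _ _

theorem boundary_boundary (x : ExteriorAlgebra R (X →₀ R)) :
    boundary R X (boundary R X x) = 0 :=
  CliffordAlgebra.contractLeft_contractLeft (Q := (0 : QuadraticForm R (X →₀ R))) _ _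

theorem ext_left_induction {V : Type*} [AddCommGroup V] [Module R V]
    {C : ExteriorAlgebra R V → Prop} (algebraMap : ∀ r : R, C (algebraMap _ _ r))
    (add : ∀ x y, C x → C y → C (x + y)) (ι_mul : ∀ x m, C x → C (ι R m * x)) (x) : C x :=
  CliffordAlgebra.left_induction (Q := (0 : QuadraticForm R V)) algebraMap add ι_mul x

variable (R X) in
/-- The grade involution of the exterior algebra. -/
def involution : ExteriorAlgebra R (X →₀ R) →ₐ[R] ExteriorAlgebra R (X →₀ R) :=
  CliffordAlgebra.involute (Q := (0 : QuadraticForm R (X →₀ R)))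

@[simp]
theorem involution_ι (v : X →₀ R) : involution R X (ι R v) = -ι R v :=
  CliffordAlgebra.involute_ι (Q := (0 : QuadraticForm R (X →₀ R))) _

theorem ι_mul_eq_involution_mul (v : X →₀ R) (x : ExteriorAlgebra R (X →₀ R)) :
    ι R v * x = involution R X x * ι R v := by
  induction x using ext_left_induction with
  | algebraMap r => rw [AlgHom.commutes, Algebra.commutes]
  | add x₁ x₂ h₁ h₂ => simp only [map_add, mul_add, add_mul, h₁, h₂]
  | ι_mul x w h =>
    rw [map_mul, involution_ι, mul_assoc, ← h, ← mul_assoc, ← mul_assoc, neg_mul,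
      eq_neg_of_add_eq_zero_left (ι_add_mul_swap v w)]

theorem boundary_mul (x y : ExteriorAlgebra R (X →₀ R)) :
    boundary R X (x * y) = boundary R X x * y + involution R X x * boundary R X y := by
  induction x using ext_left_induction with
  | algebraMap r => 
    rw [boundary_algebraMap, ← Algebra.smul_def, map_smul, AlgHom.commutes, Algebra.smul_def]
    simp
  | add x₁ x₂ h₁ h₂ => simp only [add_mul, map_add, h₁, h₂]; abel
  | ι_mul x v h =>
    rw [mul_assoc, boundary_ι_mul, boundary_ι_mul, h, map_mul, involution_ι, sub_mul,
      smul_mul_assoc]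
    noncomm_ring

theorem involution_boundary (x : ExteriorAlgebra R (X →₀ R)) :
    involution R X (boundary R X x) = -boundary R X (involution R X x) := by
  induction x using ext_left_induction with
  | algebraMap r => simp [boundary_algebraMap]
  | add x₁ x₂ h₁ h₂ => simp only [map_add, h₁, h₂]; abel
  | ι_mul x v h =>
    rw [boundary_ι_mul, map_mul, involution_ι, neg_mul, map_neg, boundary_ι_mul, map_sub, map_smul,
      map_mul, involution_ι, h]
    noncomm_ring

theorem boundary_map {f : (X →₀ R) →ₗ[R] (Y →₀ R)} (hf : coordSum R Y ∘ₗ f = coordSum R X)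
    (x : ExteriorAlgebra R (X →₀ R)) :
    boundary R Y (ExteriorAlgebra.map f x) = ExteriorAlgebra.map f (boundary R X x) := by
  induction x using ext_left_induction with
  | algebraMap r => simp [boundary_algebraMap]
  | add x₁ x₂ h₁ h₂ => simp only [map_add, h₁, h₂]
  | ι_mul x v h =>
    rw [boundary_ι_mul, map_mul, map_apply_ι, boundary_ι_mul, map_sub, map_smul, map_mul,
      map_apply_ι, h, ← hf]
    rfl

variable (R) in
/-- The linear map `x ↦ x + s(x) v`, where `s` is the sum of coordinates: it translates each
basis vector by `v`. -/
def translation (v : X →₀ R) : (X →₀ R) →ₗ[R] (X →₀ R) :=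
  LinearMap.id + (coordSum R X).smulRight v

theorem translation_apply (v x : X →₀ R) : translation R v x = x + coordSum R X x • v := rfl

theorem coordSum_comp_translation {v : X →₀ R} (hv : coordSum R X v = 0) :
    coordSum R X ∘ₗ translation R v = coordSum R X := by
  ext; simp [translation_apply, hv]

/-- Each factor of a product contributes its own copy of `v`. Since `v ∧ v = 0`, only the terms
linear in `v` survive, and they assemble to `v ∧ ∂x`. -/
theorem map_translation (v : X →₀ R) (x : ExteriorAlgebra R (X →₀ R)) :
    ExteriorAlgebra.map (translation R v) x = x + ι R v * boundary R X x := by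
  induction x using ext_left_induction with
  | algebraMap r => simp [boundary_algebraMap]
  | add x₁ x₂ h₁ h₂ => simp only [map_add, h₁, h₂, mul_add]; abel
  | ι_mul x w h =>
    have h1 : ι R v * ι R w = -(ι R w * ι R v) :=
      eq_neg_of_add_eq_zero_left (ι_add_mul_swap v w)
    rw [map_mul, map_apply_ι, h, boundary_ι_mul, translation_apply, map_add, map_smul, mul_sub,
      ← mul_assoc (ι R v) (ι R w), h1]
    have h2 : ι R v * (ι R v * boundary R X x) = 0 := by
      rw [← mul_assoc, ι_sq_zero, zero_mul]
    simp only [mul_add, add_mul, smul_mul_assoc, h2, mul_smul_comm, smul_zero]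
    noncomm_ring

theorem map_translation_boundary (v : X →₀ R) (x : ExteriorAlgebra R (X →₀ R)) :
    ExteriorAlgebra.map (translation R v) (boundary R X x) = boundary R X x := by
  rw [map_translation, boundary_boundary, mul_zero, add_zero]

variable (R) in
/-- The monomial of a list of elements. -/
def listMonomial (l : List X) : ExteriorAlgebra R (X →₀ R) := (l.map (gen R)).prod

@[simp] theorem listMonomial_nil : listMonomial R ([] : List X) = 1 := rfl

@[simp] theorem listMonomial_cons (a : X) (l : List X) :
    listMonomial R (a :: l) = gen R a * listMonomial R l := by simp [listMonomial]

theorem listMonomial_append (l l' : List X) :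
    listMonomial R (l ++ l') = listMonomial R l * listMonomial R l' := by simp [listMonomial]

theorem monomial_eq_listMonomial {n : ℕ} (S : Fin n → X) :
    monomial R S = listMonomial R (List.ofFn S) := by
  simp [monomial, listMonomial, List.map_ofFn, Function.comp_def]

theorem gen_mul_gen_swap (a b : X) : gen R a * gen R b = -(gen R b * gen R a) :=
  eq_neg_of_add_eq_zero_left (ι_add_mul_swap _ _)

theorem gen_mul_self (a : X) : gen R a * gen R a = 0 := ι_sq_zero _

theorem gen_mul_mul_gen (a : X) (x : ExteriorAlgebra R (X →₀ R)) :
    gen R a * x * gen R a = 0 := by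
  rw [gen, ι_mul_eq_involution_mul, mul_assoc, ι_sq_zero, mul_zero]

theorem gen_mul_listMonomial_of_mem {a : X} {l : List X} (h : a ∈ l) :
    gen R a * listMonomial R l = 0 := by
  induction l with
  | nil => simp at h
  | cons b l ih =>
    rw [listMonomial_cons, ← mul_assoc]
    rcases List.mem_cons.1 h with rfl | h
    · rw [gen_mul_self, zero_mul]
    · rw [gen_mul_gen_swap, neg_mul, mul_assoc, ih h, mul_zero, neg_zero]

/-- Since `e_a` already divides the monomial, `e_a ∧ e_l = 0`; applying `∂` to this product gives
the identity. -/
theorem listMonomial_eq_gen_mul_boundary {a : X} {l : List X} (h : a ∈ l) :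
    listMonomial R l = gen R a * boundary R X (listMonomial R l) := by
  have := boundary_gen_mul (R := R) a (listMonomial R l)
  rw [gen_mul_listMonomial_of_mem h, map_zero] at this
  exact sub_eq_zero.1 this.symm

theorem listMonomial_perm {l l' : List X} (h : l.Perm l') :
    listMonomial R l = listMonomial R l' ∨ listMonomial R l = -listMonomial R l' := by
  induction h with
  | nil => simp
  | cons a _ ih => rcases ih with ih | ih <;> simp [ih]
  | swap a b l =>
    right
    simp only [listMonomial_cons, ← mul_assoc, gen_mul_gen_swap b a, neg_mul]
  | trans _ _ ih₁ ih₂ => rcases ih₁ with h | h <;> rcases ih₂ with h' | h' <;> simp [h, h']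

theorem involution_listMonomial (l : List X) :
    involution R X (listMonomial R l) = listMonomial R l ∨
      involution R X (listMonomial R l) = -listMonomial R l := by
  induction l with
  | nil => simp
  | cons a l ih => rcases ih with h | h <;> simp [h, gen]

theorem map_listMonomial {f : (X →₀ R) →ₗ[R] (Y →₀ R)} {g : A → X} {h : A → Y}
    (hf : ∀ a, f (Finsupp.single (g a) 1) = Finsupp.single (h a) 1) (l : List A) :
    ExteriorAlgebra.map f (listMonomial R (l.map g)) = listMonomial R (l.map h) := by
  induction l with
  | nil => simp
  | cons a l ih => simp [ih, gen, hf]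

/-! ### Ideals generated by boundaries of monomials. -/

variable (R) in
/-- The two-sided ideal generated by the boundaries of the monomials with support in `D`. -/
def boundaryIdeal (D : Set (Set X)) : TwoSidedIdeal (ExteriorAlgebra R (X →₀ R)) :=
  TwoSidedIdeal.span {x | ∃ l : List X, {a | a ∈ l} ∈ D ∧ x = boundary R X (listMonomial R l)}

theorem boundary_listMonomial_mem {D : Set (Set X)} {l : List X} (h : {a | a ∈ l} ∈ D) :
    boundary R X (listMonomial R l) ∈ boundaryIdeal R D :=
  TwoSidedIdeal.subset_span ⟨l, h, rfl⟩

/-- The Leibniz rule for `∂` is twisted by the involution, so closure under `∂` needs closure under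
the involution as well. -/
theorem involution_mem_boundaryIdeal {D : Set (Set X)} {x : ExteriorAlgebra R (X →₀ R)}
    (hx : x ∈ boundaryIdeal R D) : involution R X x ∈ boundaryIdeal R D := by
  rw [← TwoSidedIdeal.mem_comap (f := involution R X)]
  revert x
  change boundaryIdeal R D ≤ _
  refine TwoSidedIdeal.span_le.2 ?_
  rintro _ ⟨l, hl, rfl⟩
  rw [SetLike.mem_coe, TwoSidedIdeal.mem_comap, involution_boundary]
  have := boundary_listMonomial_mem (R := R) hl
  rcases involution_listMonomial (R := R) l with h | h <;> rw [h]
  · exact neg_mem this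
  · simpa using this

theorem boundary_mem_boundaryIdeal {D : Set (Set X)} {x : ExteriorAlgebra R (X →₀ R)}
    (hx : x ∈ boundaryIdeal R D) : boundary R X x ∈ boundaryIdeal R D := by
  refine TwoSidedIdeal.span_induction (p := fun x _ => boundary R X x ∈ boundaryIdeal R D)
    ?_ ?_ ?_ ?_ ?_ ?_ hx
  · rintro _ ⟨l, hl, rfl⟩
    rw [boundary_boundary]
    exact zero_mem _
  · rw [map_zero]
    exact zero_mem _
  · intro x y _ _ h₁ h₂
    rw [map_add]
    exact add_mem h₁ h₂
  · intro x _ h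
    rw [map_neg]
    exact neg_mem h
  · intro a x hx h
    rw [boundary_mul]
    exact add_mem (TwoSidedIdeal.mul_mem_left _ _ _ hx) (TwoSidedIdeal.mul_mem_left _ _ _ h)
  · intro x a hx h
    rw [boundary_mul]
    exact add_mem (TwoSidedIdeal.mul_mem_right _ _ _ h)
      (TwoSidedIdeal.mul_mem_right _ _ _ (involution_mem_boundaryIdeal hx))

/-- Monomials depend on the order of factors only up to sign, so the factors from one piece can be
collected in front. -/
theorem exists_perm_map_append {f : A → X} (hf : f.Injective) (l : List X) :
    ∃ (L : List A) (l' : List X), l.Perm (L.map f ++ l') ∧ {a | a ∈ L} = f ⁻¹' {x | x ∈ l} ∧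
      ∀ x, x ∈ l' ↔ x ∈ l ∧ x ∉ Set.range f := by
  classical
  have h : ∀ x ∈ l.filter (· ∈ Set.range f), x ∈ Set.range f := by simp
  obtain ⟨L, hL⟩ : ∃ L : List A, L.map f = l.filter (· ∈ Set.range f) := by
    refine ⟨(l.filter (· ∈ Set.range f)).attach.map fun x => (h x.1 x.2).choose, ?_⟩
    conv_rhs => rw [← List.attach_map_subtype_val (l.filter (· ∈ Set.range f))]
    rw [List.map_map]
    exact List.map_congr_left fun x _ => (h x.1 x.2).choose_spec
  refine ⟨L, l.filter (fun x => !decide (x ∈ Set.range f)), ?_, ?_, by simp⟩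
  · rw [hL]
    exact (List.filter_append_perm _ _).symm
  · ext a
    have : f a ∈ L.map f ↔ f a ∈ l.filter (· ∈ Set.range f) := by rw [hL]
    rw [List.mem_map_of_injective hf] at this
    simpa using this

section Membership

variable {K : TwoSidedIdeal (ExteriorAlgebra R (X →₀ R))}

theorem mem_of_perm {l l' : List X} (h : l.Perm l') (hl : listMonomial R l' ∈ K) :
    listMonomial R l ∈ K := by
  rcases listMonomial_perm (R := R) h with h | h <;> rw [h]
  exacts [hl, neg_mem hl]

/-- The empty list must be excluded: its monomial is `1`, while `∂1 = 0` lies in every ideal. -/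
theorem listMonomial_mem_of_boundary_mem {l : List X} (h : l ≠ [])
    (hl : boundary R X (listMonomial R l) ∈ K) : listMonomial R l ∈ K := by
  obtain ⟨a, ha⟩ := List.exists_mem_of_ne_nil l h
  rw [listMonomial_eq_gen_mul_boundary ha]
  exact K.mul_mem_left _ _ hl

theorem listMonomial_mem_of_preimage {f : A → X} (hf : f.Injective) {D : Set (Set A)}
    (hD : ∅ ∉ D) (hK : ∀ L : List A, {a | a ∈ L} ∈ D → boundary R X (listMonomial R (L.map f)) ∈ K)
    {l : List X} (hl : f ⁻¹' {x | x ∈ l} ∈ D) : listMonomial R l ∈ K := by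
  obtain ⟨L, l', hp, hL, -⟩ := exists_perm_map_append hf l
  rw [← hL] at hl
  refine mem_of_perm hp ?_
  rw [listMonomial_append]
  refine K.mul_mem_right _ _ (listMonomial_mem_of_boundary_mem ?_ (hK L hl))
  rintro h
  rw [List.map_eq_nil_iff] at h
  subst h
  exact hD (by simpa using hl)

/-- Modulo `K` both monomials are multiples of `e_a`, namely `e_{l₀} ≡ e_a ∂e_{l₀}` and `e_{l₁} ≡
e_a ∂e_{l₁}`, and `e_a x e_a = 0`. -/
theorem listMonomial_mul_mem {a : X} {l₀ l₁ : List X}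
    (h₀ : boundary R X (listMonomial R (a :: l₀)) ∈ K)
    (h₁ : boundary R X (listMonomial R (a :: l₁)) ∈ K) :
    listMonomial R l₀ * listMonomial R l₁ ∈ K := by
  rw [listMonomial_cons, boundary_gen_mul] at h₀ h₁
  have h := K.mul_mem_right _ (gen R a * boundary R X (listMonomial R l₁)) h₀
  rw [sub_mul, ← mul_assoc (gen R a * _), gen_mul_mul_gen, zero_mul, sub_zero] at h
  have h' := K.mul_mem_left (listMonomial R l₀) _ h₁
  rw [mul_sub] at h'
  simpa using add_mem h' h

end Membership

end Algebra

/-! ### The change of generators and its effect on the two ideals. -/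

section Comparison

variable {R : Type*} [CommRing R] {X Y A B : Type*}

theorem exists_linearMap_of_compatible {V : Type*} [AddCommGroup V] [Module R V] {f : A → X}
    {g : B → X} (hf : f.Injective) (hg : g.Injective) (u : A → V) (v : B → V)
    (h : ∀ a b, f a = g b → u a = v b) :
    ∃ φ : (X →₀ R) →ₗ[R] V, (∀ a, φ (Finsupp.single (f a) 1) = u a) ∧
      ∀ b, φ (Finsupp.single (g b) 1) = v b := by
  classical
  refine ⟨Finsupp.linearCombination R fun x =>
    if hx : ∃ a, f a = x then u hx.choose else if hx : ∃ b, g b = x then v hx.choose else 0,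
    fun a => ?_, fun b => ?_⟩
  · have hx : ∃ a', f a' = f a := ⟨a, rfl⟩
    simp only [Finsupp.linearCombination_single, one_smul]
    rw [dif_pos hx, hf hx.choose_spec]
  · simp only [Finsupp.linearCombination_single, one_smul]
    split_ifs with hx hx'
    · exact h _ _ hx.choose_spec
    · rw [hg hx'.choose_spec]
    · exact absurd ⟨b, rfl⟩ hx'

theorem setOf_mem_map (f : A → X) (l : List A) : {x | x ∈ l.map f} = f '' {a | a ∈ l} := by
  ext; simp

/-- It suffices to put the monomials themselves in `K`, since `K` is closed under `∂`; each is a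
multiple of a monomial from one piece. -/
theorem boundaryIdeal_le_of_cover {i₀ : A → X} {i₁ : B → X} (hi₀ : i₀.Injective)
    (hi₁ : i₁.Injective) {D₀ : Set (Set A)} {D₁ : Set (Set B)} {D : Set (Set X)}
    (h₀ : ∅ ∉ D₀) (h₁ : ∅ ∉ D₁) (hD : ∀ s ∈ D, i₀ ⁻¹' s ∈ D₀ ∨ i₁ ⁻¹' s ∈ D₁)
    {K : TwoSidedIdeal (ExteriorAlgebra R (X →₀ R))} (hK : ∀ x ∈ K, boundary R X x ∈ K)
    (hK₀ : ∀ l : List A, {a | a ∈ l} ∈ D₀ → boundary R X (listMonomial R (l.map i₀)) ∈ K)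
    (hK₁ : ∀ l : List B, {a | a ∈ l} ∈ D₁ → boundary R X (listMonomial R (l.map i₁)) ∈ K) :
    boundaryIdeal R D ≤ K := by
  refine TwoSidedIdeal.span_le.2 ?_
  rintro _ ⟨l, hl, rfl⟩
  refine hK _ ?_
  rcases hD _ hl with h | h
  · exact listMonomial_mem_of_preimage hi₀ h₀ hK₀ h
  · exact listMonomial_mem_of_preimage hi₁ h₁ hK₁ h

theorem boundaryIdeal_le_of_pointed_cover {j₀ : A → Y} {j₁ : B → Y} (hj₀ : j₀.Injective)
    (hj₁ : j₁.Injective) {p : A} {q : B} (hj : ∀ a b, j₀ a = j₁ b ↔ a = p ∧ b = q)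
    {D₀ : Set (Set A)} {D₁ : Set (Set B)} {D : Set (Set Y)}
    (h₀ : ∅ ∉ D₀) (h₁ : ∅ ∉ D₁)
    (hD : ∀ s ∈ D, j₀ ⁻¹' s ∈ D₀ ∨ j₁ ⁻¹' s ∈ D₁ ∨
      j₀ p ∉ s ∧ insert p (j₀ ⁻¹' s) ∈ D₀ ∧ insert q (j₁ ⁻¹' s) ∈ D₁)
    {K : TwoSidedIdeal (ExteriorAlgebra R (Y →₀ R))} (hK : ∀ x ∈ K, boundary R Y x ∈ K)
    (hK₀ : ∀ l : List A, {a | a ∈ l} ∈ D₀ → boundary R Y (listMonomial R (l.map j₀)) ∈ K)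
    (hK₁ : ∀ l : List B, {a | a ∈ l} ∈ D₁ → boundary R Y (listMonomial R (l.map j₁)) ∈ K) :
    boundaryIdeal R D ≤ K := by
  refine TwoSidedIdeal.span_le.2 ?_
  rintro _ ⟨l, hl, rfl⟩
  refine hK _ ?_
  rcases hD _ hl with h | h | ⟨hp, h, h'⟩
  · exact listMonomial_mem_of_preimage hj₀ h₀ hK₀ h
  · exact listMonomial_mem_of_preimage hj₁ h₁ hK₁ h
  · obtain ⟨L₀, l', hp₀, hL₀, hl'⟩ := exists_perm_map_append hj₀ l
    obtain ⟨L₁, l'', hp₁, hL₁, -⟩ := exists_perm_map_append hj₁ l'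
    have hpq : j₀ p = j₁ q := (hj p q).2 ⟨rfl, rfl⟩
    -- `L₁` was extracted after removing the first piece; nothing of the second is lost, since the
    -- only shared point is not in `l`.
    have hL₁' : {b | b ∈ L₁} = j₁ ⁻¹' {y | y ∈ l} := by
      rw [hL₁]
      ext b
      simp only [Set.mem_preimage, Set.mem_ofPred_eq, hl', Set.mem_range, not_exists,
        and_iff_left_iff_imp]
      rintro hb a ha
      obtain ⟨rfl, rfl⟩ := (hj _ _).1 ha
      exact hp (ha ▸ hb)
    refine mem_of_perm (hp₀.trans (hp₁.append_left _)) ?_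
    rw [← List.append_assoc, listMonomial_append, listMonomial_append]
    refine K.mul_mem_right _ _ (listMonomial_mul_mem (a := j₀ p) ?_ ?_)
    · rw [← List.map_cons]
      refine hK₀ _ ?_
      convert h using 1
      rw [← hL₀]
      ext; simp
    · rw [hpq, ← List.map_cons]
      refine hK₁ _ ?_
      convert h' using 1
      rw [← hL₁']
      ext; simp

theorem boundary_mem_comap_boundaryIdeal {f : (X →₀ R) →ₗ[R] (Y →₀ R)}
    (hf : coordSum R Y ∘ₗ f = coordSum R X) {D : Set (Set Y)} {x : ExteriorAlgebra R (X →₀ R)}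
    (hx : x ∈ (boundaryIdeal R D).comap (ExteriorAlgebra.map f)) :
    boundary R X x ∈ (boundaryIdeal R D).comap (ExteriorAlgebra.map f) := by
  rw [TwoSidedIdeal.mem_comap] at hx ⊢
  rw [← boundary_map hf]
  exact boundary_mem_boundaryIdeal hx

theorem map_exteriorPower_of_surjective {V W : Type*} [AddCommGroup V] [Module R V]
    [AddCommGroup W] [Module R W] {f : V →ₗ[R] W} (hf : Function.Surjective f) (n : ℕ) :
    (⋀[R]^n V).map (ExteriorAlgebra.map f).toLinearMap = ⋀[R]^n W := by
  rw [exteriorPower, exteriorPower, Submodule.map_pow, ι_range_map_map,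
    LinearMap.range_eq_top.2 hf, Submodule.map_top]

/-- Subject to combinatorial conditions on `D` and `D'`, the linear map that sends each element of
the first piece to itself and translates the second piece by the difference of the isolated element
`z` and the base point identifies the ideals of `D` and `D'`. -/
theorem exists_algEquiv_boundaryIdeal {i₀ : A → X} {i₁ : B → X} (hi₀ : i₀.Injective)
    (hi₁ : i₁.Injective) (hi : ∀ a b, i₀ a ≠ i₁ b) (hX : ∀ x, x ∈ Set.range i₀ ∪ Set.range i₁)
    {j₀ : A → Y} {j₁ : B → Y} (hj₀ : j₀.Injective) (hj₁ : j₁.Injective) {p : A} {q : B}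
    (hj : ∀ a b, j₀ a = j₁ b ↔ a = p ∧ b = q) {z : Y} (hz₀ : ∀ a, j₀ a ≠ z)
    (hz₁ : ∀ b, j₁ b ≠ z) (hY : ∀ y, y = z ∨ y ∈ Set.range j₀ ∪ Set.range j₁)
    {D₀ : Set (Set A)} {D₁ : Set (Set B)} {D : Set (Set X)} {D' : Set (Set Y)}
    (h₀ : ∅ ∉ D₀) (h₁ : ∅ ∉ D₁)
    (hD₀ : ∀ s ∈ D₀, i₀ '' s ∈ D) (hD₁ : ∀ s ∈ D₁, i₁ '' s ∈ D)
    (hD : ∀ s ∈ D, i₀ ⁻¹' s ∈ D₀ ∨ i₁ ⁻¹' s ∈ D₁)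
    (hD₀' : ∀ s ∈ D₀, j₀ '' s ∈ D') (hD₁' : ∀ s ∈ D₁, j₁ '' s ∈ D')
    (hD' : ∀ s ∈ D', j₀ ⁻¹' s ∈ D₀ ∨ j₁ ⁻¹' s ∈ D₁ ∨
      j₀ p ∉ s ∧ insert p (j₀ ⁻¹' s) ∈ D₀ ∧ insert q (j₁ ⁻¹' s) ∈ D₁) :
    ∃ e : ExteriorAlgebra R (X →₀ R) ≃ₐ[R] ExteriorAlgebra R (Y →₀ R),
      (∀ x, e x ∈ boundaryIdeal R D' ↔ x ∈ boundaryIdeal R D) ∧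
      ∀ n : ℕ, (⋀[R]^n (X →₀ R)).map e.toLinearMap = ⋀[R]^n (Y →₀ R) := by
  have hpq : j₀ p = j₁ q := (hj p q).2 ⟨rfl, rfl⟩
  obtain ⟨f, hf₀, hf₁⟩ := exists_linearMap_of_compatible (R := R) hi₀ hi₁
    (fun a => Finsupp.single (j₀ a) (1 : R))
    (fun b => Finsupp.single (j₁ b) 1 + (Finsupp.single z 1 - Finsupp.single (j₀ p) 1))
    (fun a b h => absurd h (hi a b))
  -- For the inverse, the isolated point `z` is adjoined to the first piece as `none`. The two
  -- pieces then overlap only in the base point, where the prescribed values agree.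
  have hj₀z : Function.Injective fun o : Option A => o.elim z j₀ := by
    rintro (_ | a) (_ | a') h
    · rfl
    · exact absurd h.symm (hz₀ _)
    · exact absurd h (hz₀ _)
    · exact congrArg some (hj₀ h)
  obtain ⟨g, hg₀, hg₁⟩ := exists_linearMap_of_compatible (R := R) hj₀z hj₁
    (fun o => o.elim (Finsupp.single (i₁ q) (1 : R)) fun a => Finsupp.single (i₀ a) 1)
    (fun b => Finsupp.single (i₁ b) 1 + (Finsupp.single (i₀ p) 1 - Finsupp.single (i₁ q) 1)) (by
      rintro (_ | a) b h
      · exact absurd h.symm (hz₁ b)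
      · obtain ⟨rfl, rfl⟩ := (hj a b).1 h
        simp)
  have hgz : g (Finsupp.single z 1) = Finsupp.single (i₁ q) 1 := hg₀ none
  replace hg₀ : ∀ a, g (Finsupp.single (j₀ a) 1) = Finsupp.single (i₀ a) 1 :=
    fun a => hg₀ (some a)
  have hgf : g ∘ₗ f = LinearMap.id := by
    refine Finsupp.lhom_ext' fun x => LinearMap.ext_ring ?_
    rcases hX x with ⟨a, rfl⟩ | ⟨b, rfl⟩
    · simp [hf₀, hg₀]
    · simp only [LinearMap.comp_apply, Finsupp.lsingle_apply, hf₁, hg₁, hg₀, hgz, map_add, map_sub,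
        LinearMap.id_apply]
      abel
  have hfg : f ∘ₗ g = LinearMap.id := by
    refine Finsupp.lhom_ext' fun y => LinearMap.ext_ring ?_
    rcases hY y with rfl | ⟨a, rfl⟩ | ⟨b, rfl⟩
    · simp [hgz, hf₁, hpq]
    · simp [hf₀, hg₀]
    · simp only [LinearMap.comp_apply, Finsupp.lsingle_apply, hf₁, hg₁, hf₀, hpq, map_add, map_sub,
        LinearMap.id_apply]
      abel
  have hf : coordSum R Y ∘ₗ f = coordSum R X := by
    refine Finsupp.lhom_ext' fun x => LinearMap.ext_ring ?_
    rcases hX x with ⟨a, rfl⟩ | ⟨b, rfl⟩ <;> simp [hf₀, hf₁]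
  have hg : coordSum R X ∘ₗ g = coordSum R Y := by
    rw [← hf, LinearMap.comp_assoc, hfg, LinearMap.comp_id]
  have hgf' : (ExteriorAlgebra.map g).comp (ExteriorAlgebra.map f) = AlgHom.id R _ := by
    rw [map_comp_map, hgf, map_id]
  have hfg' : (ExteriorAlgebra.map f).comp (ExteriorAlgebra.map g) = AlgHom.id R _ := by
    rw [map_comp_map, hfg, map_id]
  have hb₀ : ∀ l : List A, ExteriorAlgebra.map f (boundary R X (listMonomial R (l.map i₀))) =
      boundary R Y (listMonomial R (l.map j₀)) := fun l => by
    rw [← boundary_map hf, map_listMonomial hf₀]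
  have hb₁ : ∀ l : List B, ExteriorAlgebra.map f (boundary R X (listMonomial R (l.map i₁))) =
      boundary R Y (listMonomial R (l.map j₁)) := fun l => by
    set v : Y →₀ R := Finsupp.single z 1 - Finsupp.single (j₀ p) 1
    have hv : coordSum R Y v = 0 := by simp [v]
    -- On the second piece, `f` is relabelling followed by translation by `v`; only boundaries, not
    -- the monomials, forget the translation.
    have : ExteriorAlgebra.map f (listMonomial R (l.map i₁)) =
        ExteriorAlgebra.map (translation R v) (listMonomial R (l.map j₁)) := by
      induction l with
      | nil => simp
      | cons b l ih => simp [ih, gen, hf₁, translation_apply, v]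
    rw [← boundary_map hf, this, boundary_map (coordSum_comp_translation hv),
      map_translation_boundary]
  have hb₀' : ∀ l : List A, ExteriorAlgebra.map g (boundary R Y (listMonomial R (l.map j₀))) =
      boundary R X (listMonomial R (l.map i₀)) := fun l => by
    rw [← hb₀]
    exact DFunLike.congr_fun hgf' _
  have hb₁' : ∀ l : List B, ExteriorAlgebra.map g (boundary R Y (listMonomial R (l.map j₁))) =
      boundary R X (listMonomial R (l.map i₁)) := fun l => by
    rw [← hb₁]
    exact DFunLike.congr_fun hgf' _
  have hle : boundaryIdeal R D ≤ (boundaryIdeal R D').comap (ExteriorAlgebra.map f) := by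
    refine boundaryIdeal_le_of_cover hi₀ hi₁ h₀ h₁ hD
      (fun x hx => boundary_mem_comap_boundaryIdeal hf hx) (fun l hl => ?_) fun l hl => ?_
    · rw [TwoSidedIdeal.mem_comap, hb₀]
      exact boundary_listMonomial_mem (setOf_mem_map j₀ l ▸ hD₀' _ hl)
    · rw [TwoSidedIdeal.mem_comap, hb₁]
      exact boundary_listMonomial_mem (setOf_mem_map j₁ l ▸ hD₁' _ hl)
  have hle' : boundaryIdeal R D' ≤ (boundaryIdeal R D).comap (ExteriorAlgebra.map g) := by
    refine boundaryIdeal_le_of_pointed_cover hj₀ hj₁ hj h₀ h₁ hD'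
      (fun x hx => boundary_mem_comap_boundaryIdeal hg hx) (fun l hl => ?_) fun l hl => ?_
    · rw [TwoSidedIdeal.mem_comap, hb₀']
      exact boundary_listMonomial_mem (setOf_mem_map i₀ l ▸ hD₀ _ hl)
    · rw [TwoSidedIdeal.mem_comap, hb₁']
      exact boundary_listMonomial_mem (setOf_mem_map i₁ l ▸ hD₁ _ hl)
  refine ⟨AlgEquiv.ofAlgHom (ExteriorAlgebra.map f) (ExteriorAlgebra.map g) hfg' hgf',
    fun x => ⟨fun hx => ?_, fun hx => ?_⟩, fun n => ?_⟩
  · have := hle' hx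
    rw [TwoSidedIdeal.mem_comap] at this
    have hx' : ExteriorAlgebra.map g (ExteriorAlgebra.map f x) = x := DFunLike.congr_fun hgf' x
    exact hx' ▸ this
  · exact TwoSidedIdeal.mem_comap _ |>.1 (hle hx)
  · exact map_exteriorPower_of_surjective
      (fun y => ⟨g y, DFunLike.congr_fun hfg y⟩) n

end Comparison

/-! ### From the exterior algebra to the graded Orlik–Solomon quotient. -/

section Matroid

variable (R : Type*) [CommRing R] {α β : Type*}

theorem osIdeal_eq_boundaryIdeal (M : Matroid α) :
    osIdeal R M = (boundaryIdeal R {s : Set M.E | M.Dep (Subtype.val '' s)}).asIdeal := by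
  rw [osIdeal, boundaryIdeal]
  congr 2
  ext x
  constructor
  · rintro ⟨n, S, hS, rfl⟩
    refine ⟨List.ofFn S, ?_, by rw [monomial_eq_listMonomial]⟩
    have : Subtype.val '' {a | a ∈ List.ofFn S} = Set.range fun k => (S k : α) := by
      ext; simp [List.mem_ofFn]
    rwa [Set.mem_ofPred_eq, this]
  · rintro ⟨l, hl, rfl⟩
    refine ⟨l.length, l.get, ?_, by rw [monomial_eq_listMonomial, List.ofFn_get]⟩
    have : (Set.range fun k => (l.get k : α)) = Subtype.val '' {a | a ∈ l} := by
      rw [Set.range_comp' Subtype.val, Set.range_list_get]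
    rwa [this]

theorem ideal_eq_map_of_mem_iff {S T : Type*} [Ring S] [Algebra R S] [Ring T] [Algebra R T]
    (e : S ≃ₐ[R] T) {I : Ideal S} {J : Ideal T} (h : ∀ x, e x ∈ J ↔ x ∈ I) :
    J = I.map (e : S →+* T) := by
  ext y
  obtain ⟨x, rfl⟩ := e.surjective y
  rw [h]
  refine ⟨fun hx => Ideal.mem_map_of_mem (e : S →+* T) hx, fun hx => ?_⟩
  obtain ⟨x', hx', hxx⟩ := (Ideal.mem_map_iff_of_surjective (e : S →+* T) e.surjective).1 hx
  exact e.injective hxx ▸ hx'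

theorem map_mk_quotientEquivAlg {S T : Type*} [Ring S] [Algebra R S] [Ring T] [Algebra R T]
    (e : S ≃ₐ[R] T) {I : Ideal S} {J : Ideal T} [I.IsTwoSided] [J.IsTwoSided]
    (h : J = I.map (e : S →+* T)) {V : Submodule R S} {W : Submodule R T}
    (hVW : V.map e.toLinearMap = W) :
    (V.map (Ideal.Quotient.mkₐ R I).toLinearMap).map
      (Ideal.quotientEquivAlg I J e h).toLinearMap =
        W.map (Ideal.Quotient.mkₐ R J).toLinearMap := by
  rw [← hVW, ← Submodule.map_comp, ← Submodule.map_comp]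
  rfl

theorem hasIsomorphicOSAlgebras_of_algEquiv {M : Matroid α} {N : Matroid β}
    (e : ExteriorAlgebra R (M.E →₀ R) ≃ₐ[R] ExteriorAlgebra R (N.E →₀ R))
    (h : ∀ x, e x ∈ osIdeal R N ↔ x ∈ osIdeal R M)
    (hdeg : ∀ n : ℕ, (⋀[R]^n (M.E →₀ R)).map e.toLinearMap = ⋀[R]^n (N.E →₀ R)) :
    HasIsomorphicOSAlgebras R M N :=
  ⟨Ideal.quotientEquivAlg _ _ e (ideal_eq_map_of_mem_iff R e h),
    fun n => map_mk_quotientEquivAlg R e _ (hdeg n)⟩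

end Matroid

/-! ### Parallel connections: an explicit construction, and dependence under the rank bound. -/

section ParallelConnection

variable {γ : Type*} {M₀ M₁ : Matroid γ} {b : γ}

/-- The independent sets of the parallel connection of `M₀` and `M₁`, two matroids whose ground
sets meet only in `b`. -/
def ParallelIndep (M₀ M₁ : Matroid γ) (b : γ) (S : Set γ) : Prop :=
  S ⊆ M₀.E ∪ M₁.E ∧ M₀.Indep (S ∩ M₀.E) ∧ M₁.Indep (S ∩ M₁.E) ∧
    (M₀.Indep (insert b (S ∩ M₀.E)) ∨ M₁.Indep (insert b (S ∩ M₁.E)))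

theorem ParallelIndep.symm {S : Set γ} (h : ParallelIndep M₀ M₁ b S) :
    ParallelIndep M₁ M₀ b S :=
  ⟨Set.union_comm M₀.E M₁.E ▸ h.1, h.2.2.1, h.2.1, h.2.2.2.symm⟩

theorem ParallelIndep.subset {S T : Set γ} (h : ParallelIndep M₀ M₁ b S) (hTS : T ⊆ S) :
    ParallelIndep M₀ M₁ b T :=
  ⟨hTS.trans h.1, h.2.1.subset (by gcongr), h.2.2.1.subset (by gcongr),
    h.2.2.2.imp (fun h => h.subset (by gcongr)) fun h => h.subset (by gcongr)⟩

/-- An element other than `b` lies in only one ground set, so only one trace changes. -/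
theorem ParallelIndep.insert_left (hb : M₀.E ∩ M₁.E = {b}) {S : Set γ} {e : γ}
    (h : ParallelIndep M₀ M₁ b S) (heb : e ≠ b) (hi : M₀.Indep (insert e (S ∩ M₀.E)))
    (hor : M₀.Indep (insert b (insert e (S ∩ M₀.E))) ∨ M₁.Indep (insert b (S ∩ M₁.E))) :
    ParallelIndep M₀ M₁ b (insert e S) := by
  have he : e ∈ M₀.E := hi.subset_ground (Set.mem_insert _ _)
  have he' : e ∉ M₁.E := fun he' => heb (hb.subset ⟨he, he'⟩)
  rw [ParallelIndep, Set.insert_inter_of_mem he, Set.insert_inter_of_notMem he']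
  exact ⟨Set.insert_subset (Or.inl he) h.1, hi, h.2.2.1, hor⟩

theorem ParallelIndep.insert_right (hb : M₀.E ∩ M₁.E = {b}) {S : Set γ} {e : γ}
    (h : ParallelIndep M₀ M₁ b S) (heb : e ≠ b) (hi : M₁.Indep (insert e (S ∩ M₁.E)))
    (hor : M₀.Indep (insert b (S ∩ M₀.E)) ∨ M₁.Indep (insert b (insert e (S ∩ M₁.E)))) :
    ParallelIndep M₀ M₁ b (insert e S) :=
  (h.symm.insert_left (Set.inter_comm M₀.E M₁.E ▸ hb) heb hi hor.symm).symm

theorem ncard_inter_add_ncard_inter {E₀ E₁ S : Set γ} (hb : E₀ ∩ E₁ = {b}) (hS : S ⊆ E₀ ∪ E₁)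
    (hfin : S.Finite) :
    (b ∈ S → (S ∩ E₀).ncard + (S ∩ E₁).ncard = S.ncard + 1) ∧
      (b ∉ S → (S ∩ E₀).ncard + (S ∩ E₁).ncard = S.ncard) := by
  have h := Set.ncard_union_add_ncard_inter (S ∩ E₀) (S ∩ E₁) (hfin.inter_of_left _)
    (hfin.inter_of_left _)
  rw [← Set.inter_union_distrib_left, Set.inter_eq_left.2 hS, ← Set.inter_inter_distrib_left,
    hb] at h
  refine ⟨fun hbS => ?_, fun hbS => ?_⟩
  · rw [Set.inter_singleton_of_mem hbS, Set.ncard_singleton] at h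
    exact h.symm
  · rw [Set.inter_singleton_eq_empty.2 hbS, Set.ncard_empty] at h
    exact h.symm

theorem exists_insert_of_ncard_lt {M : Matroid γ} [M.Finite] {I J : Set γ} (hI : M.Indep I)
    (hJ : M.Indep J) (h : I.ncard < J.ncard) : ∃ e ∈ J, e ∉ I ∧ M.Indep (insert e I) := by
  have hfin : ∀ {K}, M.Indep K → K.Finite := fun hK => M.ground_finite.subset hK.subset_ground
  obtain ⟨e, he, hi⟩ := hI.exists_insert_of_encard_lt hJ (by
    rw [← (hfin hI).cast_ncard_eq, ← (hfin hJ).cast_ncard_eq]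
    exact_mod_cast h)
  exact ⟨e, he.1, he.2, hi⟩

/-- If `I` could not be augmented, augmentation in `M₀` and `M₁` would bound the traces of `J`,
enlarged by `b` where independent, by those of `I`. As `b` is counted in both traces, adding the
bounds gives `|J| ≤ |I|` in each case. -/
theorem ParallelIndep.augment_of_indep_insert [M₀.Finite] [M₁.Finite]
    (hb : M₀.E ∩ M₁.E = {b}) {I J : Set γ} (hI : ParallelIndep M₀ M₁ b I)
    (hJ : ParallelIndep M₀ M₁ b J) (hIJ : I.ncard < J.ncard)
    (hbI : M₀.Indep (insert b (I ∩ M₀.E))) :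
    ∃ e ∈ J, e ∉ I ∧ ParallelIndep M₀ M₁ b (insert e I) := by
  by_contra! hcon
  have hb₀ : b ∈ M₀.E := (hb.symm.subset rfl).1
  have hb₁ : b ∈ M₁.E := (hb.symm.subset rfl).2
  have hE : (M₀.E ∪ M₁.E).Finite := M₀.ground_finite.union M₁.ground_finite
  have hIf : I.Finite := hE.subset hI.1
  have hJf : J.Finite := hE.subset hJ.1
  obtain ⟨cI, cI'⟩ := ncard_inter_add_ncard_inter hb hI.1 hIf
  obtain ⟨cJ, cJ'⟩ := ncard_inter_add_ncard_inter hb hJ.1 hJf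
  have hJ₀ : b ∉ J → (insert b (J ∩ M₀.E)).ncard = (J ∩ M₀.E).ncard + 1 := fun h =>
    Set.ncard_insert_of_notMem (fun h' => h h'.1) (hJf.inter_of_left _)
  have hJ₁ : b ∉ J → (insert b (J ∩ M₁.E)).ncard = (J ∩ M₁.E).ncard + 1 := fun h =>
    Set.ncard_insert_of_notMem (fun h' => h h'.1) (hJf.inter_of_left _)
  have key₀ : ∀ {K}, M₀.Indep K → K ⊆ insert b (J ∩ M₀.E) →
      (∀ e, M₀.Indep (insert e (I ∩ M₀.E)) → e ∈ K → e ∉ I → e ≠ b ∧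
        (M₀.Indep (insert b (insert e (I ∩ M₀.E))) ∨ M₁.Indep (insert b (I ∩ M₁.E)))) →
      K.ncard ≤ (I ∩ M₀.E).ncard := by
    intro K hK hKJ h
    by_contra! hlt
    obtain ⟨e, heK, heI, hi⟩ := exists_insert_of_ncard_lt hI.2.1 hK hlt
    have he : e ∈ M₀.E := hi.subset_ground (Set.mem_insert _ _)
    have heI' : e ∉ I := fun h => heI ⟨h, he⟩
    obtain ⟨heb, hor⟩ := h e hi heK heI'
    exact hcon e ((hKJ heK).resolve_left heb).1 heI' (hI.insert_left hb heb hi hor)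
  have key₁ : ∀ {K}, M₁.Indep K → K ⊆ insert b (J ∩ M₁.E) →
      (∀ e, M₁.Indep (insert e (I ∩ M₁.E)) → e ∈ K → e ∉ I → e ≠ b) →
      K.ncard ≤ (I ∩ M₁.E).ncard := by
    intro K hK hKJ h
    by_contra! hlt
    obtain ⟨e, heK, heI, hi⟩ := exists_insert_of_ncard_lt hI.2.2.1 hK hlt
    have he : e ∈ M₁.E := hi.subset_ground (Set.mem_insert _ _)
    have heI' : e ∉ I := fun h => heI ⟨h, he⟩
    have heb := h e hi heK heI'
    exact hcon e ((hKJ heK).resolve_left heb).1 heI' (hI.insert_right hb heb hi (Or.inl hbI))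
  by_cases hbI' : b ∈ I
  · have ne : ∀ e, e ∉ I → e ≠ b := fun e he h => he (h ▸ hbI')
    have side : ∀ e, M₀.Indep (insert e (I ∩ M₀.E)) →
        M₀.Indep (insert b (insert e (I ∩ M₀.E))) := fun e h => by
      rwa [Set.insert_eq_of_mem (Set.mem_insert_of_mem e (show b ∈ I ∩ M₀.E from ⟨hbI', hb₀⟩))]
    have k₀ : ∀ {K}, M₀.Indep K → K ⊆ insert b (J ∩ M₀.E) → K.ncard ≤ (I ∩ M₀.E).ncard :=
      fun hK hKJ => key₀ hK hKJ fun e hi _ he => ⟨ne e he, Or.inl (side e hi)⟩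
    have k₁ : ∀ {K}, M₁.Indep K → K ⊆ insert b (J ∩ M₁.E) → K.ncard ≤ (I ∩ M₁.E).ncard :=
      fun hK hKJ => key₁ hK hKJ fun e _ _ he => ne e he
    have := k₀ hJ.2.1 (Set.subset_insert _ _)
    have := k₁ hJ.2.2.1 (Set.subset_insert _ _)
    have := cI hbI'
    by_cases hbJ : b ∈ J
    · have := cJ hbJ
      omega
    · have := cJ' hbJ
      have := hJ₀ hbJ
      have := hJ₁ hbJ
      rcases hJ.2.2.2 with h | h
      · have := k₀ h subset_rfl
        omega
      · have := k₁ h subset_rfl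
        omega
  · have cI := cI' hbI'
    by_cases hbI₁ : M₁.Indep (insert b (I ∩ M₁.E))
    · have hbJ : b ∉ J := fun hbJ => hcon b hbJ hbI' (by
        rw [ParallelIndep, Set.insert_inter_of_mem hb₀, Set.insert_inter_of_mem hb₁]
        exact ⟨Set.insert_subset (Or.inl hb₀) hI.1, hbI, hbI₁, Or.inl (by simpa using hbI)⟩)
      have ne : ∀ e ∈ J, e ≠ b := fun e he h => hbJ (h ▸ he)
      have := key₀ hJ.2.1 (Set.subset_insert _ _) fun e _ he _ => ⟨ne e he.1, Or.inr hbI₁⟩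
      have := key₁ hJ.2.2.1 (Set.subset_insert _ _) fun e _ he _ => ne e he.1
      have := cJ' hbJ
      omega
    · have k₁ : ∀ {K}, M₁.Indep K → K ⊆ insert b (J ∩ M₁.E) → K.ncard ≤ (I ∩ M₁.E).ncard :=
        fun hK hKJ => key₁ hK hKJ fun e hi _ _ h => hbI₁ (h ▸ hi)
      -- With `I ∩ M₁.E` spanning `b` in `M₁`, an element added on the left must keep `b`
      -- independent there. So augmentation starts from `insert b (I ∩ M₀.E)`, which costs one in
      -- the bound.
      have k₀ : ∀ {K}, M₀.Indep K → K ⊆ insert b (J ∩ M₀.E) →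
          K.ncard ≤ (I ∩ M₀.E).ncard + 1 := by
        intro K hK hKJ
        rw [← Set.ncard_insert_of_notMem (fun h : b ∈ I ∩ M₀.E => hbI' h.1)
          (hIf.inter_of_left _)]
        by_contra! hlt
        obtain ⟨e, heK, heI, hi⟩ := exists_insert_of_ncard_lt hbI hK hlt
        have he : e ∈ M₀.E := hi.subset_ground (Set.mem_insert _ _)
        have heb : e ≠ b := fun h => heI (h ▸ Set.mem_insert _ _)
        rw [Set.insert_comm] at hi
        exact hcon e ((hKJ heK).resolve_left heb).1
          (fun h => heI (Set.mem_insert_of_mem _ ⟨h, he⟩))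
          (hI.insert_left hb heb (hi.subset (Set.subset_insert _ _)) (Or.inl hi))
      have := k₀ hJ.2.1 (Set.subset_insert _ _)
      have := k₁ hJ.2.2.1 (Set.subset_insert _ _)
      by_cases hbJ : b ∈ J
      · have := cJ hbJ
        omega
      · have := cJ' hbJ
        have := hJ₀ hbJ
        have := hJ₁ hbJ
        rcases hJ.2.2.2 with h | h
        · have := k₀ h subset_rfl
          omega
        · have := k₁ h subset_rfl
          omega

theorem ParallelIndep.augment [M₀.Finite] [M₁.Finite]
    (hb : M₀.E ∩ M₁.E = {b}) {I J : Set γ} (hI : ParallelIndep M₀ M₁ b I)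
    (hJ : ParallelIndep M₀ M₁ b J) (hIJ : I.ncard < J.ncard) :
    ∃ e ∈ J, e ∉ I ∧ ParallelIndep M₀ M₁ b (insert e I) := by
  rcases hI.2.2.2 with h | h
  · exact hI.augment_of_indep_insert hb hJ hIJ h
  · obtain ⟨e, he, heI, h⟩ := hI.symm.augment_of_indep_insert (Set.inter_comm M₀.E M₁.E ▸ hb)
      hJ.symm hIJ h
    exact ⟨e, he, heI, h.symm⟩

theorem ParallelIndep.symm_iff {S : Set γ} :
    ParallelIndep M₀ M₁ b S ↔ ParallelIndep M₁ M₀ b S := ⟨.symm, .symm⟩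

theorem parallelIndep_iff_of_subset_left (hb : M₀.E ∩ M₁.E = {b}) (h₁ : M₁.Indep {b})
    {S : Set γ} (hS : S ⊆ M₀.E) : ParallelIndep M₀ M₁ b S ↔ M₀.Indep S := by
  have hS₁ : S ∩ M₁.E ⊆ {b} := hb ▸ Set.inter_subset_inter_left _ hS
  rw [ParallelIndep, Set.inter_eq_left.2 hS]
  refine ⟨fun h => h.2.1, fun h => ⟨hS.trans Set.subset_union_left, h, h₁.subset hS₁, Or.inr ?_⟩⟩
  exact h₁.subset (Set.insert_subset rfl hS₁)

/-- Two finite matroids whose ground sets meet in a single point, not a loop, have a common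
extension of rank at least one less than the sum of their ranks. -/
theorem exists_restrict_eq_of_inter_ground_eq_singleton [M₀.Finite] [M₁.Finite]
    (hb : M₀.E ∩ M₁.E = {b}) (h₀ : M₀.Indep {b}) (h₁ : M₁.Indep {b}) :
    ∃ Q : Matroid γ, Q.E = M₀.E ∪ M₁.E ∧ Q ↾ M₀.E = M₀ ∧ Q ↾ M₁.E = M₁ ∧
      M₀.eRank + M₁.eRank ≤ Q.eRank + 1 := by
  have hb' : M₁.E ∩ M₀.E = {b} := Set.inter_comm M₀.E M₁.E ▸ hb
  let Q : IndepMatroid γ := IndepMatroid.ofFinite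
    (M₀.ground_finite.union M₁.ground_finite) (ParallelIndep M₀ M₁ b)
    ((parallelIndep_iff_of_subset_left hb h₁ (Set.empty_subset _)).2 M₀.empty_indep)
    (fun _ _ h hs => h.subset hs) (fun _ _ hI hJ hIJ => hI.augment hb hJ hIJ) (fun _ h => h.1)
  have hQ : ∀ S, Q.matroid.Indep S ↔ ParallelIndep M₀ M₁ b S := fun S => Iff.rfl
  refine ⟨Q.matroid, rfl, ?_, ?_, ?_⟩
  · refine Matroid.ext_indep rfl fun I hI => ?_
    rw [Matroid.restrict_indep_iff, hQ]
    exact (and_iff_left hI).trans (parallelIndep_iff_of_subset_left hb h₁ hI)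
  · refine Matroid.ext_indep rfl fun I hI => ?_
    rw [Matroid.restrict_indep_iff, hQ, ParallelIndep.symm_iff]
    exact (and_iff_left hI).trans (parallelIndep_iff_of_subset_left hb' h₀ hI)
  -- Bases through `b` on both sides meet exactly in `b`, so their union is independent of size one
  -- less than the sum of the ranks.
  · obtain ⟨B₀, hB₀, hbB₀⟩ := h₀.exists_isBase_superset
    obtain ⟨B₁, hB₁, hbB₁⟩ := h₁.exists_isBase_superset
    have e₀ : (B₀ ∪ B₁) ∩ M₀.E = B₀ := by
      rw [Set.union_inter_distrib_right, Set.inter_eq_left.2 hB₀.subset_ground]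
      exact Set.union_eq_left.2
        (((Set.inter_subset_inter_left _ hB₁.subset_ground).trans hb'.subset).trans hbB₀)
    have e₁ : (B₀ ∪ B₁) ∩ M₁.E = B₁ := by
      rw [Set.union_inter_distrib_right, Set.inter_eq_left.2 hB₁.subset_ground]
      exact Set.union_eq_right.2
        (((Set.inter_subset_inter_left _ hB₀.subset_ground).trans hb.subset).trans hbB₁)
    have hB : Q.matroid.Indep (B₀ ∪ B₁) := by
      rw [hQ, ParallelIndep, e₀, e₁]
      refine ⟨Set.union_subset_union hB₀.subset_ground hB₁.subset_ground, hB₀.indep, hB₁.indep,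
        Or.inl ?_⟩
      rw [Set.insert_eq_of_mem (hbB₀ rfl)]
      exact hB₀.indep
    rw [← hB₀.encard_eq_eRank, ← hB₁.encard_eq_eRank, ← Set.encard_union_add_encard_inter]
    gcongr
    · exact hB.encard_le_eRank
    · rw [← Set.encard_singleton b, ← hb]
      exact Set.encard_le_encard
        (Set.inter_subset_inter hB₀.subset_ground hB₁.subset_ground)

/-- Extend the two traces to bases of `E₀` and `E₁`. The rank bound makes a spanning set of size
`|B₀| + |B₁| - 1` independent, so it is enough to find one containing `S`. -/
theorem indep_of_indep_insert_inter {P : Matroid γ} [P.RankFinite] {E₀ E₁ : Set γ}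
    (hE : P.E = E₀ ∪ E₁) (hb : E₀ ∩ E₁ = {b}) (hr : P.eRk E₀ + P.eRk E₁ ≤ P.eRank + 1)
    {S : Set γ} (hS : S ⊆ P.E) (h₀ : P.Indep (insert b (S ∩ E₀))) (h₁ : P.Indep (S ∩ E₁)) :
    P.Indep S := by
  have hb₀ : b ∈ E₀ := (hb.symm.subset rfl).1
  have hb₁ : b ∈ E₁ := (hb.symm.subset rfl).2
  obtain ⟨B₀, hB₀, hSB₀⟩ := h₀.subset_isBasis_of_subset
    (Set.insert_subset hb₀ Set.inter_subset_right) (hE ▸ Set.subset_union_left)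
  obtain ⟨B₁, hB₁, hSB₁⟩ := h₁.subset_isBasis_of_subset Set.inter_subset_right
    (hE ▸ Set.subset_union_right)
  have hbB₀ : b ∈ B₀ := hSB₀ (Set.mem_insert _ _)
  have hSsub : S ⊆ S ∩ E₀ ∪ S ∩ E₁ := by
    rw [← Set.inter_union_distrib_left, ← hE]
    exact Set.subset_inter subset_rfl hS
  have hSB₀' : S ∩ E₀ ⊆ B₀ := (Set.subset_insert _ _).trans hSB₀
  have hinter : B₀ ∩ B₁ ⊆ {b} := (Set.inter_subset_inter hB₀.subset hB₁.subset).trans hb.subset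
  rw [← hB₀.encard_eq_eRk, ← hB₁.encard_eq_eRk] at hr
  have hfull : P.eRk (B₀ ∪ E₁) = P.eRank := by
    rw [hB₀.eRk_eq_eRk_union, ← hE, Matroid.eRk_ground]
  suffices h : ∃ B, S ⊆ B ∧ B.encard + 1 = B₀.encard + B₁.encard ∧ P.eRk B = P.eRank by
    obtain ⟨B, hSB, hcard, hrk⟩ := h
    refine (Matroid.IsRkFinite.indep_of_encard_le_eRk (P.isRkFinite_set B) ?_).subset hSB
    rw [hrk]
    rw [← hcard] at hr
    exact (ENat.add_le_add_iff_right (by simp)).1 hr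
  by_cases hbB₁ : b ∈ B₁
  · refine ⟨B₀ ∪ B₁, hSsub.trans (Set.union_subset_union hSB₀' hSB₁), ?_, ?_⟩
    · rw [← Set.encard_union_add_encard_inter,
        hinter.antisymm (Set.singleton_subset_iff.2 ⟨hbB₀, hbB₁⟩), Set.encard_singleton]
    · rw [← hfull, Set.union_comm, hB₁.eRk_eq_eRk_union, Set.union_comm]
  · have hbS : b ∉ S := fun h => hbB₁ (hSB₁ ⟨h, hb₁⟩)
    -- Here `b` may be dropped: `B₁` spans `E₁`, hence `b`, and `S` does not contain it.
    refine ⟨(B₀ \ {b}) ∪ B₁, hSsub.trans (Set.union_subset_union (fun x hx => ?_) hSB₁), ?_, ?_⟩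
    · exact ⟨hSB₀' hx, fun h => hbS (h ▸ hx.1)⟩
    · have hdisj : Disjoint (B₀ \ {b}) B₁ := Set.disjoint_left.2 fun x hx hx' =>
        hx.2 (hinter ⟨hx.1, hx'⟩)
      rw [Set.encard_union_eq hdisj, add_right_comm, Set.encard_sdiff_singleton_add_one hbB₀]
    · rw [← hfull, Set.union_comm, hB₁.eRk_eq_eRk_union]
      congr 1
      ext x
      by_cases hx : x = b <;> simp [hx, hb₁, hbB₀, or_comm]

/-- The rank bound is required only when `b` is not a loop. Failure of all three alternatives makes
`b` independent with one of the traces, so it is then available. -/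
theorem dep_inter_or_of_dep {P : Matroid γ} [P.RankFinite] {E₀ E₁ : Set γ}
    (hE : P.E = E₀ ∪ E₁) (hb : E₀ ∩ E₁ = {b})
    (hr : P.Indep {b} → P.eRk E₀ + P.eRk E₁ ≤ P.eRank + 1) {S : Set γ} (hS : P.Dep S) :
    P.Dep (S ∩ E₀) ∨ P.Dep (S ∩ E₁) ∨
      b ∉ S ∧ P.Dep (insert b (S ∩ E₀)) ∧ P.Dep (insert b (S ∩ E₁)) := by
  have hb₀ : b ∈ E₀ := (hb.symm.subset rfl).1
  have hb₁ : b ∈ E₁ := (hb.symm.subset rfl).2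
  have hbE : b ∈ P.E := hE ▸ Or.inl hb₀
  have hsub : ∀ E, S ∩ E ⊆ P.E := fun E => Set.inter_subset_left.trans hS.subset_ground
  have hsub' : ∀ E, insert b (S ∩ E) ⊆ P.E := fun E => Set.insert_subset hbE (hsub E)
  by_contra! hcon
  rw [Matroid.not_dep_iff (hsub _), Matroid.not_dep_iff (hsub _),
    Matroid.not_dep_iff (hsub' _)] at hcon
  obtain ⟨h₀, h₁, hor⟩ := hcon
  refine hS.not_indep ?_
  by_cases hi : P.Indep (insert b (S ∩ E₀))
  · exact indep_of_indep_insert_inter hE hb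
      (hr (hi.subset (Set.singleton_subset_iff.2 (Set.mem_insert _ _)))) hS.subset_ground hi h₁
  · have hbS : b ∉ S := fun hbS => hi (by rwa [Set.insert_eq_of_mem (show b ∈ S ∩ E₀ from ⟨hbS, hb₀⟩)])
    have hi' := hor hbS ((Matroid.not_indep_iff (hsub' _)).1 hi)
    refine indep_of_indep_insert_inter (hE.trans (Set.union_comm _ _))
      ((Set.inter_comm _ _).trans hb) ?_ hS.subset_ground hi' h₀
    rw [add_comm]
    exact hr (hi'.subset (Set.singleton_subset_iff.2 (Set.mem_insert _ _)))

end ParallelConnection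

/-! ### Dependent sets of the two matroids, and the isomorphism. -/

section Main

variable {α β γ : Type*} {G₀ : Matroid α} {G₁ : Matroid β} {P : Matroid γ} {p : α} {q : β} {b : γ}

theorem IsSubmatroidEmbedding.dep_image_iff {f : α → γ} (hf : IsSubmatroidEmbedding G₀ P f)
    {s : Set α} (hs : s ⊆ G₀.E) : P.Dep (f '' s) ↔ G₀.Dep s := by
  have hs' : f '' s ⊆ f '' G₀.E := Set.image_mono hs
  rw [← not_iff_not, Matroid.not_dep_iff (hs'.trans hf.image_subset), Matroid.not_dep_iff hs,
    ← Matroid.map_image_indep_iff (hf := hf.injOn) hs, ← hf.restrict_eq,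
    Matroid.restrict_indep_iff, and_iff_left hs']

theorem sum_dep_iff (M : Matroid α) (N : Matroid β) {S : Set (α ⊕ β)}
    (hS : S ⊆ (M.sum N).E) :
    (M.sum N).Dep S ↔ M.Dep (Sum.inl ⁻¹' S) ∨ N.Dep (Sum.inr ⁻¹' S) := by
  have h₀ : Sum.inl ⁻¹' S ⊆ M.E := fun x hx => by simpa using hS hx
  have h₁ : Sum.inr ⁻¹' S ⊆ N.E := fun x hx => by simpa using hS hx
  rw [← Matroid.not_indep_iff hS, Matroid.sum_indep_iff, ← Matroid.not_indep_iff h₀,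
    ← Matroid.not_indep_iff h₁, not_and_or]

/-- The competitor is glued from the restrictions of `P` itself. It has the same ground set and is a
pointed union through the same `f₀` and `f₁`, so maximality of `P` applies to it. -/
theorem eRk_add_eRk_le_of_isParallelConnection [G₀.Finite] [G₁.Finite] {f₀ : α → γ} {f₁ : β → γ}
    (hP : ∀ (P' : Matroid γ) (b' : γ), IsPointedUnion G₀ p G₁ q P' b' → P'.eRank ≤ P.eRank)
    (hp : p ∈ G₀.E) (hq : q ∈ G₁.E)
    (hf₀ : IsSubmatroidEmbedding G₀ P f₀) (hf₁ : IsSubmatroidEmbedding G₁ P f₁)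
    (hfp : f₀ p = b) (hfq : f₁ q = b) (hinter : f₀ '' G₀.E ∩ f₁ '' G₁.E = {b})
    (hb : P.Indep {b}) :
    P.eRk (f₀ '' G₀.E) + P.eRk (f₁ '' G₁.E) ≤ P.eRank + 1 := by
  have hb₀ : {b} ⊆ f₀ '' G₀.E := Set.singleton_subset_iff.2 ⟨p, hp, hfp⟩
  have hb₁ : {b} ⊆ f₁ '' G₁.E := Set.singleton_subset_iff.2 ⟨q, hq, hfq⟩
  have : (P ↾ (f₀ '' G₀.E)).Finite := ⟨G₀.ground_finite.image _⟩
  have : (P ↾ (f₁ '' G₁.E)).Finite := ⟨G₁.ground_finite.image _⟩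
  obtain ⟨Q, hQE, hQ₀, hQ₁, hQr⟩ := exists_restrict_eq_of_inter_ground_eq_singleton
    (M₀ := P ↾ (f₀ '' G₀.E)) (M₁ := P ↾ (f₁ '' G₁.E)) hinter
    (Matroid.restrict_indep_iff.2 ⟨hb, hb₀⟩) (Matroid.restrict_indep_iff.2 ⟨hb, hb₁⟩)
  rw [Matroid.restrict_ground_eq, Matroid.restrict_ground_eq] at hQE
  rw [Matroid.restrict_ground_eq] at hQ₀ hQ₁
  have hle := hP Q b ⟨hp, hq, f₀, f₁,
    ⟨hf₀.injOn, hQE ▸ Set.subset_union_left, hQ₀.trans hf₀.restrict_eq⟩,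
    ⟨hf₁.injOn, hQE ▸ Set.subset_union_right, hQ₁.trans hf₁.restrict_eq⟩,
    hfp, hfq, hQE, hinter⟩
  rw [Matroid.eRank_restrict, Matroid.eRank_restrict] at hQr
  exact hQr.trans (by gcongr)

theorem IsParallelConnection.hasIsomorphicOSAlgebras (R : Type*) [CommRing R] [G₀.Finite]
    [G₁.Finite] (hP : IsParallelConnection G₀ p G₁ q P b) :
    HasIsomorphicOSAlgebras R (G₀.sum G₁) (isthmus.sum P) := by
  obtain ⟨⟨hp, hq, f₀, f₁, hf₀, hf₁, hfp, hfq, hPE, hinter⟩, hmax⟩ := hP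
  have : P.Finite := ⟨hPE ▸ (G₀.ground_finite.image _).union (G₁.ground_finite.image _)⟩
  have hX₀ : ∀ a : G₀.E, Sum.inl a.1 ∈ (G₀.sum G₁).E := fun a => by simp
  have hX₁ : ∀ a : G₁.E, Sum.inr a.1 ∈ (G₀.sum G₁).E := fun a => by simp
  have hY₀ : ∀ a : G₀.E, Sum.inr (f₀ a.1) ∈ (isthmus.sum P).E := fun a => by
    simpa using hf₀.image_subset ⟨a, a.2, rfl⟩
  have hY₁ : ∀ a : G₁.E, Sum.inr (f₁ a.1) ∈ (isthmus.sum P).E := fun a => by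
    simpa using hf₁.image_subset ⟨a, a.2, rfl⟩
  have hz : Sum.inl () ∈ (isthmus.sum P).E := by simp [isthmus]
  let i₀ : G₀.E → (G₀.sum G₁).E := fun a => ⟨Sum.inl a.1, hX₀ a⟩
  let i₁ : G₁.E → (G₀.sum G₁).E := fun a => ⟨Sum.inr a.1, hX₁ a⟩
  let j₀ : G₀.E → (isthmus.sum P).E := fun a => ⟨Sum.inr (f₀ a.1), hY₀ a⟩
  let j₁ : G₁.E → (isthmus.sum P).E := fun a => ⟨Sum.inr (f₁ a.1), hY₁ a⟩
  have hi₀ : i₀.Injective := fun a a' h => Subtype.ext (Sum.inl_injective (congrArg Subtype.val h))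
  have hi₁ : i₁.Injective := fun a a' h => Subtype.ext (Sum.inr_injective (congrArg Subtype.val h))
  have hj₀ : j₀.Injective := fun a a' h =>
    Subtype.ext (hf₀.injOn a.2 a'.2 (Sum.inr_injective (congrArg Subtype.val h)))
  have hj₁ : j₁.Injective := fun a a' h =>
    Subtype.ext (hf₁.injOn a.2 a'.2 (Sum.inr_injective (congrArg Subtype.val h)))
  have hj : ∀ a a', j₀ a = j₁ a' ↔ a = ⟨p, hp⟩ ∧ a' = ⟨q, hq⟩ := by
    refine fun a a' => ⟨fun h => ?_, ?_⟩
    · have h' : f₀ a = f₁ a' := Sum.inr_injective (congrArg Subtype.val h)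
      have hb : f₀ a = b := hinter.subset ⟨⟨a, a.2, rfl⟩, h' ▸ ⟨a', a'.2, rfl⟩⟩
      exact ⟨Subtype.ext (hf₀.injOn a.2 hp (hb.trans hfp.symm)),
        Subtype.ext (hf₁.injOn a'.2 hq ((h'.symm.trans hb).trans hfq.symm))⟩
    · rintro ⟨rfl, rfl⟩
      exact Subtype.ext (congrArg Sum.inr (hfp.trans hfq.symm))
  have hXcover : ∀ x, x ∈ Set.range i₀ ∪ Set.range i₁ := by
    rintro ⟨x | x, hx⟩
    · exact Or.inl ⟨⟨x, by simpa using hx⟩, rfl⟩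
    · exact Or.inr ⟨⟨x, by simpa using hx⟩, rfl⟩
  have hYcover : ∀ y, y = ⟨Sum.inl (), hz⟩ ∨ y ∈ Set.range j₀ ∪ Set.range j₁ := by
    rintro ⟨_ | y, hy⟩
    · exact Or.inl rfl
    · have hy' : y ∈ P.E := by simpa using hy
      rw [hPE] at hy'
      rcases hy' with ⟨a, ha, rfl⟩ | ⟨a, ha, rfl⟩
      · exact Or.inr (Or.inl ⟨⟨a, ha⟩, rfl⟩)
      · exact Or.inr (Or.inr ⟨⟨a, ha⟩, rfl⟩)
  have hXdep : ∀ s : Set (G₀.sum G₁).E, (G₀.sum G₁).Dep (Subtype.val '' s) ↔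
      G₀.Dep (Subtype.val '' (i₀ ⁻¹' s)) ∨ G₁.Dep (Subtype.val '' (i₁ ⁻¹' s)) := fun s => by
    have h₀ : Sum.inl ⁻¹' (Subtype.val '' s) = Subtype.val '' (i₀ ⁻¹' s) := by
      ext x
      constructor
      · rintro ⟨⟨_, hx⟩, hs, rfl⟩
        exact ⟨⟨x, by simpa using hx⟩, hs, rfl⟩
      · rintro ⟨a, ha, rfl⟩
        exact ⟨i₀ a, ha, rfl⟩
    have h₁ : Sum.inr ⁻¹' (Subtype.val '' s) = Subtype.val '' (i₁ ⁻¹' s) := by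
      ext x
      constructor
      · rintro ⟨⟨_, hx⟩, hs, rfl⟩
        exact ⟨⟨x, by simpa using hx⟩, hs, rfl⟩
      · rintro ⟨a, ha, rfl⟩
        exact ⟨i₁ a, ha, rfl⟩
    rw [sum_dep_iff _ _ (Subtype.coe_image_subset _ _), h₀, h₁]
  have hYdep : ∀ s : Set (isthmus.sum P).E, (isthmus.sum P).Dep (Subtype.val '' s) ↔
      P.Dep (Sum.inr ⁻¹' (Subtype.val '' s)) := fun s => by
    rw [sum_dep_iff _ _ (Subtype.coe_image_subset _ _), or_iff_right]
    -- The isthmus carries no dependent sets, so dependence is decided in `P`.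
    exact fun h => h.not_indep (Matroid.freeOn_indep (Set.subset_univ _))
  have hdep₀ : ∀ s : Set G₀.E, P.Dep (f₀ '' (Subtype.val '' s)) ↔ G₀.Dep (Subtype.val '' s) :=
    fun s => hf₀.dep_image_iff (Subtype.coe_image_subset _ _)
  have hdep₁ : ∀ s : Set G₁.E, P.Dep (f₁ '' (Subtype.val '' s)) ↔ G₁.Dep (Subtype.val '' s) :=
    fun s => hf₁.dep_image_iff (Subtype.coe_image_subset _ _)
  have hpre₀ : ∀ s : Set (isthmus.sum P).E, f₀ '' (Subtype.val '' (j₀ ⁻¹' s)) =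
      Sum.inr ⁻¹' (Subtype.val '' s) ∩ f₀ '' G₀.E := fun s => by
    ext y
    constructor
    · rintro ⟨_, ⟨a, ha, rfl⟩, rfl⟩
      exact ⟨⟨j₀ a, ha, rfl⟩, a, a.2, rfl⟩
    · rintro ⟨⟨y', hy', h⟩, a, ha, rfl⟩
      obtain rfl : y' = j₀ ⟨a, ha⟩ := Subtype.ext h
      exact ⟨a, ⟨⟨a, ha⟩, hy', rfl⟩, rfl⟩
  have hpre₁ : ∀ s : Set (isthmus.sum P).E, f₁ '' (Subtype.val '' (j₁ ⁻¹' s)) =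
      Sum.inr ⁻¹' (Subtype.val '' s) ∩ f₁ '' G₁.E := fun s => by
    ext y
    constructor
    · rintro ⟨_, ⟨a, ha, rfl⟩, rfl⟩
      exact ⟨⟨j₁ a, ha, rfl⟩, a, a.2, rfl⟩
    · rintro ⟨⟨y', hy', h⟩, a, ha, rfl⟩
      obtain rfl : y' = j₁ ⟨a, ha⟩ := Subtype.ext h
      exact ⟨a, ⟨⟨a, ha⟩, hy', rfl⟩, rfl⟩
  obtain ⟨e, he, hdeg⟩ := exists_algEquiv_boundaryIdeal (R := R) (p := ⟨p, hp⟩) (q := ⟨q, hq⟩)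
    (z := ⟨Sum.inl (), hz⟩)
    (D₀ := {s | G₀.Dep (Subtype.val '' s)}) (D₁ := {s | G₁.Dep (Subtype.val '' s)})
    (D := {s | (G₀.sum G₁).Dep (Subtype.val '' s)})
    (D' := {s | (isthmus.sum P).Dep (Subtype.val '' s)})
    hi₀ hi₁ (fun a a' h => Sum.inl_ne_inr (congrArg Subtype.val h)) hXcover hj₀ hj₁ hj
    (fun a h => Sum.inr_ne_inl (congrArg Subtype.val h))
    (fun a h => Sum.inr_ne_inl (congrArg Subtype.val h)) hYcover
    (fun h => h.nonempty.ne_empty (Set.image_empty _))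
    (fun h => h.nonempty.ne_empty (Set.image_empty _))
    (fun s hs => (hXdep _).2 (Or.inl (by rwa [Set.preimage_image_eq _ hi₀])))
    (fun s hs => (hXdep _).2 (Or.inr (by rwa [Set.preimage_image_eq _ hi₁])))
    (fun s hs => (hXdep s).1 hs)
    (fun s hs => (hYdep _).2 <| ((hdep₀ s).2 hs).superset (by
        rintro _ ⟨_, ⟨a, ha, rfl⟩, rfl⟩
        exact ⟨j₀ a, ⟨a, ha, rfl⟩, rfl⟩)
      (fun y hy => by simpa using Subtype.coe_image_subset _ _ hy))
    (fun s hs => (hYdep _).2 <| ((hdep₁ s).2 hs).superset (by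
        rintro _ ⟨_, ⟨a, ha, rfl⟩, rfl⟩
        exact ⟨j₁ a, ⟨a, ha, rfl⟩, rfl⟩)
      (fun y hy => by simpa using Subtype.coe_image_subset _ _ hy))
    (fun s hs => by
      have hbs : j₀ ⟨p, hp⟩ ∈ s → b ∈ Sum.inr ⁻¹' (Subtype.val '' s) := fun h =>
        ⟨_, h, congrArg Sum.inr hfp⟩
      have := dep_inter_or_of_dep hPE hinter
        (eRk_add_eRk_le_of_isParallelConnection hmax hp hq hf₀ hf₁ hfp hfq hinter)
        ((hYdep s).1 hs)
      -- Dependence in `G₀` and `G₁` is transported into `P`, where the preimages become the traces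
      -- on the two embedded ground sets and both base points become `b`.
      simp only [Set.mem_ofPred_eq, ← hdep₀, ← hdep₁, Set.image_insert_eq, hpre₀, hpre₁, hfp, hfq]
      exact this.imp_right (Or.imp_right (And.imp_left (mt hbs))))
  refine hasIsomorphicOSAlgebras_of_algEquiv R e (fun x => ?_) hdeg
  rw [osIdeal_eq_boundaryIdeal, osIdeal_eq_boundaryIdeal, TwoSidedIdeal.mem_asIdeal,
    TwoSidedIdeal.mem_asIdeal, he]

end Main

end OrlikSolomon

end

theorem theorem3p9 {R : Type*} [CommRing R] {α β γ : Type*}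
    (G₀ : Matroid α) (G₁ : Matroid β) [G₀.Finite] [G₁.Finite] (p : α) (q : β)
    (P : Matroid γ) (b : γ) (hP : OrlikSolomon.IsParallelConnection G₀ p G₁ q P b) :
    OrlikSolomon.HasIsomorphicOSAlgebras R (G₀.sum G₁) (OrlikSolomon.isthmus.sum P) :=
  hP.hasIsomorphicOSAlgebras R
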